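/- Let $n\in\mathbb N$, and let $\mathcal H=\{h_\nu\}_{\nu=1}^\infty$ be a family of convex functions $h_\nu:\mathbb R^n\to\mathbb R$ such that for each $\nu$: 1) $h_\nu(x)=h_\nu(|x_1|,\dots,|x_n|)$ for $x\in\mathbb R^n$; 2) the restriction of $h_\nu$ to $[0,\infty)^n$ is nondecreasing in each variable; 3) $\lim_{x\to\infty} h_\nu(x)/\|x\|=+\infty$, where $\|\cdot\|$ is the Euclidean norm; 4) for each $M>0$ there is a constant $A_{\nu,M}>0$ such that $h_\nu(x)\le\sum_{1\le j\le n:\,x_j\ne0}x_j\ln\frac{x_j}{M}+A_{\nu,M}$ for $x\in[0,\infty)^n$; 5) there is a constant $\gamma_\nu$ such that $h_\nu(x)-h_{\nu+1}(x)\ge\ln2\cdot\sum_{j=1}^n x_j-\gamma_\nu$ for $x\in[0,\infty)^n$; 6) there is a constant $l_\nu$ such that $h_{\nu+1}(x+y)\le h_\nu(x)+h_\nu(y)+l_\nu$ for $x,y\in[0,\infty)^n$. For $g:\mathbb R^n\to\mathbb R$ let $g^*(x)=\sup_{y\in\mathbb R^n}(\langle x,y\rangle-g(y))$ be its Young–Fenchel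 conjugate, and put $\varphi_\nu(x)=h_\nu^*(\ln(1+|x_1|),\dots,\ln(1+|x_n|))$ for $x\in\mathbb R^n$, and $\varPhi^*=\{\varphi_\nu^*\}_{\nu=1}^\infty$. (All these conjugates are finite.) Let $G(h_\nu)$ be the space of all $f\in C^\infty(\mathbb R^n)$ (complex-valued) such that for every $m\in\mathbb Z_+$ $$\|f\|_{m,h_\nu}=\sup_{x\in\mathbb R^n,\ \beta\in\mathbb Z_+^n,\ |\alpha|\le m}\frac{|x^\beta (D^\alpha f)(x)|}{\beta!\,e^{-h_\nu(\beta)}}<\infty ,$$ with the topology defined by these norms, and let $G(\mathcal H)=\bigcup_{\nu}G(h_\nu)$ with the (locally convex) inductive limit topology. Let $GS(\varphi_\nu^*)$ be the space of all $f\in C^\infty(\mathbb R^n)$ such that for every $m\in\mathbb Z_+$ $$q_{m,\nu}(f)=\sup_{x\in\mathbb R^n,\ |\alpha|\le m}\frac{|(D^\alpha f)(x)|}{e^{-\varphi_\nu^*(x)}}<\infty ,$$ with the topology defined by these norms, and let $GS(\varPhi^*)=\bigcup_\nu GS(\varphi_\nu^*)$ with the (locally convex) inductive limit topology. Suppose that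 there are convex functions $\theta_\nu:\mathbb R^n\to\mathbb R$ ($\nu\in\mathbb N$) such that for each $\nu$: $\theta_\nu(x)=\theta_\nu(|x_1|,\dots,|x_n|)$ for $x\in\mathbb R^n$; the restriction of $\theta_\nu$ to $[0,\infty)^n$ is nondecreasing in each variable; and there is a constant $a_\nu>0$ such that $|\varphi_\nu(x)-\theta_\nu(x)|\le a_\nu$ for all $x\in\mathbb R^n$. Then $G(\mathcal H)=GS(\varPhi^*)$: the two spaces consist of the same functions, and their inductive limit topologies coincide. -/

import Mathlib

open Topology

noncomputable section

namespace GelfandShilov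

/-- The Euclidean space `ℝⁿ`. -/
abbrev Rn (n : ℕ) : Type := EuclideanSpace ℝ (Fin n)

/-- The vector `(|x₁|, …, |xₙ|)`. -/
def absVec {n : ℕ} (x : Rn n) : Rn n := WithLp.toLp 2 fun j => |x j|

/-- A multi-index regarded as a point of `ℝⁿ`. -/
def natVec {n : ℕ} (β : Fin n → ℕ) : Rn n := WithLp.toLp 2 fun j => (β j : ℝ)

/-- `g(x) = g(|x₁|, …, |xₙ|)` for all `x`. -/
def EvenInEach {n : ℕ} (g : Rn n → ℝ) : Prop := ∀ x, g x = g (absVec x)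

/-- The restriction of `g` to `[0, ∞)ⁿ` is nondecreasing in each variable. -/
def NondecreasingOnOrthant {n : ℕ} (g : Rn n → ℝ) : Prop :=
  ∀ x y : Rn n, (∀ j, 0 ≤ x j) → (∀ j, x j ≤ y j) → g x ≤ g y

/-- The Young–Fenchel conjugate `g^*(x) = sup_y (⟨x, y⟩ - g(y))`.  It is only applied to functions
for which this supremum is finite, see `WeightFamily.bddAbove_conj` and
`WeightFamily.bddAbove_conj_phi`. -/
def conj {n : ℕ} (g : Rn n → ℝ) (x : Rn n) : ℝ := ⨆ y : Rn n, ((∑ j, x j * y j) - g y)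

/-- `φ(x) = h^*(ln (1 + |x₁|), …, ln (1 + |xₙ|))`. -/
def phi {n : ℕ} (h : Rn n → ℝ) (x : Rn n) : ℝ :=
  conj h (WithLp.toLp 2 fun j => Real.log (1 + |x j|))

/-- The conditions on the family `H = {h_ν}` of convex weight functions.  In `growth` a term with
`x j = 0` vanishes. -/
structure WeightFamily {n : ℕ} (h : ℕ → Rn n → ℝ) : Prop where
  convex : ∀ ν, ConvexOn ℝ Set.univ (h ν)
  even : ∀ ν, EvenInEach (h ν)
  mono : ∀ ν, NondecreasingOnOrthant (h ν)
  superlinear : ∀ ν,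
    Filter.Tendsto (fun x : Rn n => h ν x / ‖x‖) (Bornology.cobounded (Rn n)) Filter.atTop
  growth : ∀ ν, ∀ M : ℝ, 0 < M → ∃ A : ℝ, 0 < A ∧ ∀ x : Rn n, (∀ j, 0 ≤ x j) →
    h ν x ≤ (∑ j, x j * Real.log (x j / M)) + A
  gap : ∀ ν, ∃ γ : ℝ, ∀ x : Rn n, (∀ j, 0 ≤ x j) →
    Real.log 2 * (∑ j, x j) - γ ≤ h ν x - h (ν + 1) x
  subadd : ∀ ν, ∃ l : ℝ, ∀ x y : Rn n, (∀ j, 0 ≤ x j) → (∀ j, 0 ≤ y j) →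
    h (ν + 1) (x + y) ≤ h ν x + h ν y + l

/-- The supremum defining `h_ν^*(x)` is finite. -/
theorem WeightFamily.bddAbove_conj {n : ℕ} {h : ℕ → Rn n → ℝ} (hH : WeightFamily h) (ν : ℕ)
    (x : Rn n) : BddAbove (Set.range fun y : Rn n => (∑ j, x j * y j) - h ν y) := by
  obtain ⟨R, -, hR⟩ := ((Metric.hasBasis_cobounded_compl_closedBall (0 : Rn n)).eventually_iff).1
    ((hH.superlinear ν).eventually_ge_atTop ‖x‖)
  have hin : ∀ y : Rn n, (∑ j, x j * y j) ≤ ‖x‖ * ‖y‖ := fun y => by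
    have := real_inner_le_norm x y
    simpa [PiLp.inner_apply, mul_comm] using this
  have h0 : ∀ y : Rn n, h ν 0 ≤ h ν y := fun y => by
    rw [hH.even ν y]
    exact hH.mono ν _ _ (by simp) (by simp [absVec])
  refine ⟨max 0 (‖x‖ * max R 0 - h ν 0), ?_⟩
  rintro _ ⟨y, rfl⟩
  have h1 := hin y
  have h2 := h0 y
  dsimp only
  by_cases hy : ‖y‖ ≤ max R 0
  · refine le_max_of_le_right ?_
    have := mul_le_mul_of_nonneg_left hy (norm_nonneg x)
    linarith
  · refine le_max_of_le_left ?_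
    obtain ⟨hy1, hy2⟩ := max_lt_iff.1 (not_le.1 hy)
    have h3 : ‖x‖ ≤ h ν y / ‖y‖ := hR (by simpa using hy1)
    rw [le_div_iff₀ hy2] at h3
    linarith

/-- `φ_ν` grows faster than any linear function. -/
theorem WeightFamily.le_phi {n : ℕ} {h : ℕ → Rn n → ℝ} (hH : WeightFamily h) (ν : ℕ) {M : ℝ}
    (hM : 0 < M) : ∃ A : ℝ, ∀ y : Rn n, M * (∑ j, |y j|) - A ≤ phi (h ν) y := by
  obtain ⟨A, -, hA⟩ := hH.growth ν (Real.exp 1 * M) (by positivity)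
  refine ⟨A, fun y => ?_⟩
  have hpos : ∀ j, 0 < 1 + |y j| := fun j => by positivity
  refine le_trans ?_ (le_ciSup (hH.bddAbove_conj ν _) (WithLp.toLp 2 fun j => M * (1 + |y j|)))
  have h1 := hA (WithLp.toLp 2 fun j => M * (1 + |y j|)) (fun j => by
    have := hpos j
    simp only
    positivity)
  have h2 : ∀ j, M * (1 + |y j|) * Real.log (M * (1 + |y j|) / (Real.exp 1 * M)) =
      Real.log (1 + |y j|) * (M * (1 + |y j|)) - M * (1 + |y j|) := fun j => by
    have h3 : M * (1 + |y j|) / (Real.exp 1 * M) = (1 + |y j|) / Real.exp 1 := by field_simp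
    rw [h3, Real.log_div (hpos j).ne' (Real.exp_ne_zero 1), Real.log_exp]
    ring
  simp only [h2, Finset.sum_sub_distrib] at h1
  have h4 : M * (∑ j, |y j|) ≤ ∑ j, M * (1 + |y j|) := by
    rw [Finset.mul_sum]
    exact Finset.sum_le_sum fun j _ => by linarith
  simp only
  linarith

/-- The supremum defining `φ_ν^*(x)` is finite. -/
theorem WeightFamily.bddAbove_conj_phi {n : ℕ} {h : ℕ → Rn n → ℝ} (hH : WeightFamily h) (ν : ℕ)
    (x : Rn n) : BddAbove (Set.range fun y : Rn n => (∑ j, x j * y j) - phi (h ν) y) := by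
  obtain ⟨A, hA⟩ := hH.le_phi ν (M := ‖x‖ + 1) (by positivity)
  refine ⟨A, ?_⟩
  rintro _ ⟨y, rfl⟩
  have h1 := hA y
  have h2 : (∑ j, x j * y j) ≤ (‖x‖ + 1) * ∑ j, |y j| := by
    rw [Finset.mul_sum]
    refine Finset.sum_le_sum fun j _ => ?_
    have h3 : |x j| ≤ ‖x‖ := by simpa using PiLp.norm_apply_le x j
    calc x j * y j ≤ |x j * y j| := le_abs_self _
      _ = |x j| * |y j| := abs_mul _ _
      _ ≤ (‖x‖ + 1) * |y j| := by gcongr; linarith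
  dsimp only
  linarith

/-! ### Partial derivatives -/

/-- The partial derivative in the `j`-th coordinate (of a differentiable function). -/
def pderiv {n : ℕ} (j : Fin n) (f : Rn n → ℂ) : Rn n → ℂ :=
  fun x => fderiv ℝ f x (EuclideanSpace.single j (1 : ℝ))

/-- `D^α f = ∂₁^{α₁} ⋯ ∂ₙ^{αₙ} f` (for `f` of class `C^{|α|}`). -/
def multiDeriv {n : ℕ} (α : Fin n → ℕ) (f : Rn n → ℂ) : Rn n → ℂ :=
  (List.finRange n).foldr (fun j g => (pderiv j)^[α j] g) f

theorem contDiff_iterate_pderiv {n : ℕ} (j : Fin n) (k : ℕ) {f : Rn n → ℂ}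
    (hf : ∀ m : ℕ, ContDiff ℝ m f) : ∀ m : ℕ, ContDiff ℝ m ((pderiv j)^[k] f) := by
  induction k generalizing f with
  | zero => simpa using hf
  | succ k ih =>
    rw [Function.iterate_succ_apply]
    refine ih fun m => ?_
    have := (hf (m + 1)).fderiv_right (m := (m : WithTop ℕ∞)) (by norm_cast)
    exact this.clm_apply contDiff_const

theorem pderiv_add {n : ℕ} (j : Fin n) {f g : Rn n → ℂ} (hf : ContDiff ℝ 1 f)
    (hg : ContDiff ℝ 1 g) : pderiv j (f + g) = pderiv j f + pderiv j g := by
  funext x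
  simp only [pderiv, Pi.add_apply]
  rw [fderiv_add (hf.differentiable one_ne_zero x) (hg.differentiable one_ne_zero x)]
  rfl

theorem pderiv_smul {n : ℕ} (j : Fin n) (c : ℂ) {f : Rn n → ℂ} (hf : ContDiff ℝ 1 f) :
    pderiv j (c • f) = c • pderiv j f := by
  funext x
  simp only [pderiv, Pi.smul_apply]
  rw [fderiv_const_smul (hf.differentiable one_ne_zero x) c]
  rfl

theorem iterate_pderiv_add {n : ℕ} (j : Fin n) (k : ℕ) {f g : Rn n → ℂ}
    (hf : ∀ m : ℕ, ContDiff ℝ m f) (hg : ∀ m : ℕ, ContDiff ℝ m g) :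
    (pderiv j)^[k] (f + g) = (pderiv j)^[k] f + (pderiv j)^[k] g := by
  induction k with
  | zero => rfl
  | succ k ih =>
    simp only [Function.iterate_succ_apply', ih]
    exact pderiv_add j (by simpa using contDiff_iterate_pderiv j k hf 1)
      (by simpa using contDiff_iterate_pderiv j k hg 1)

theorem iterate_pderiv_smul {n : ℕ} (j : Fin n) (k : ℕ) (c : ℂ) {f : Rn n → ℂ}
    (hf : ∀ m : ℕ, ContDiff ℝ m f) : (pderiv j)^[k] (c • f) = c • (pderiv j)^[k] f := by
  induction k with
  | zero => rfl
  | succ k ih =>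
    simp only [Function.iterate_succ_apply', ih]
    exact pderiv_smul j c (by simpa using contDiff_iterate_pderiv j k hf 1)

theorem contDiff_foldr {n : ℕ} (α : Fin n → ℕ) (L : List (Fin n)) {f : Rn n → ℂ}
    (hf : ∀ m : ℕ, ContDiff ℝ m f) :
    ∀ m : ℕ, ContDiff ℝ m (L.foldr (fun j g => (pderiv j)^[α j] g) f) := by
  induction L with
  | nil => simpa using hf
  | cons j L ih => exact contDiff_iterate_pderiv j (α j) ih

theorem multiDeriv_add {n : ℕ} (α : Fin n → ℕ) {f g : Rn n → ℂ}
    (hf : ∀ m : ℕ, ContDiff ℝ m f) (hg : ∀ m : ℕ, ContDiff ℝ m g) :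
    multiDeriv α (f + g) = multiDeriv α f + multiDeriv α g := by
  unfold multiDeriv
  induction List.finRange n with
  | nil => rfl
  | cons j L ih =>
    simp only [List.foldr_cons, ih]
    exact iterate_pderiv_add j (α j) (contDiff_foldr α L hf) (contDiff_foldr α L hg)

theorem multiDeriv_smul {n : ℕ} (α : Fin n → ℕ) (c : ℂ) {f : Rn n → ℂ}
    (hf : ∀ m : ℕ, ContDiff ℝ m f) : multiDeriv α (c • f) = c • multiDeriv α f := by
  unfold multiDeriv
  induction List.finRange n with
  | nil => rfl
  | cons j L ih =>
    simp only [List.foldr_cons, ih]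
    exact iterate_pderiv_smul j (α j) c (contDiff_foldr α L hf)

/-! ### Weighted spaces of smooth functions -/

/-- The numbers `|w_i(x) (D^α f)(x)|`, `i ∈ ι`, `x ∈ ℝⁿ`, `|α| ≤ m`, for a family `w` of weight
functions. -/
def normSet {n : ℕ} {ι : Type} (w : ι → Rn n → ℝ) (m : ℕ) (f : Rn n → ℂ) : Set ℝ :=
  {r | ∃ (i : ι) (x : Rn n) (α : Fin n → ℕ), (∑ j, α j) ≤ m ∧ r = ‖w i x • multiDeriv α f x‖}

theorem bound_add {n : ℕ} {ι : Type} (w : ι → Rn n → ℝ) (m : ℕ) {f g : Rn n → ℂ} {a b : ℝ}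
    (hf : ∀ m : ℕ, ContDiff ℝ m f) (hg : ∀ m : ℕ, ContDiff ℝ m g)
    (ha : a ∈ upperBounds (normSet w m f)) (hb : b ∈ upperBounds (normSet w m g)) :
    a + b ∈ upperBounds (normSet w m (f + g)) := by
  rintro _ ⟨i, x, α, hα, rfl⟩
  rw [multiDeriv_add α hf hg, Pi.add_apply, smul_add]
  exact (norm_add_le _ _).trans
    (add_le_add (ha ⟨i, x, α, hα, rfl⟩) (hb ⟨i, x, α, hα, rfl⟩))

theorem bound_smul {n : ℕ} {ι : Type} (w : ι → Rn n → ℝ) (m : ℕ) (c : ℂ) {f : Rn n → ℂ} {a : ℝ}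
    (hf : ∀ m : ℕ, ContDiff ℝ m f) (ha : a ∈ upperBounds (normSet w m f)) :
    ‖c‖ * a ∈ upperBounds (normSet w m (c • f)) := by
  rintro _ ⟨i, x, α, hα, rfl⟩
  rw [multiDeriv_smul α c hf, Pi.smul_apply, smul_comm, norm_smul]
  exact mul_le_mul_of_nonneg_left (ha ⟨i, x, α, hα, rfl⟩) (norm_nonneg c)

/-- The space of all `f : ℝⁿ → ℂ` such that for every `m` the function `f` is of class `C^m` and
`sup {|w_i(x) (D^α f)(x)| : i ∈ ι, x ∈ ℝⁿ, |α| ≤ m}` is finite. -/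
def weightedSpace {n : ℕ} {ι : Type} (w : ι → Rn n → ℝ) : Submodule ℂ (Rn n → ℂ) where
  carrier := {f | ∀ m : ℕ, ContDiff ℝ m f ∧ BddAbove (normSet w m f)}
  add_mem' := by
    intro f g hf hg m
    refine ⟨(hf m).1.add (hg m).1, ?_⟩
    obtain ⟨a, ha⟩ := (hf m).2
    obtain ⟨b, hb⟩ := (hg m).2
    exact ⟨a + b, bound_add w m (fun k => (hf k).1) (fun k => (hg k).1) ha hb⟩
  zero_mem' := by
    intro m
    have h0 : ∀ k : ℕ, ContDiff ℝ k (0 : Rn n → ℂ) := fun k => contDiff_const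
    refine ⟨h0 m, 0, ?_⟩
    rintro _ ⟨i, x, α, -, rfl⟩
    have := multiDeriv_smul α 0 h0
    simp only [zero_smul] at this
    simp [this]
  smul_mem' := by
    intro c f hf m
    refine ⟨contDiff_const.smul (hf m).1, ?_⟩
    obtain ⟨a, ha⟩ := (hf m).2
    exact ⟨‖c‖ * a, bound_smul w m c (fun k => (hf k).1) ha⟩

/-- The `m`-th norm `sup {|w_i(x) (D^α f)(x)| : i ∈ ι, x ∈ ℝⁿ, |α| ≤ m}`. -/
def weightedNorm {n : ℕ} {ι : Type} (w : ι → Rn n → ℝ) (m : ℕ) :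
    Seminorm ℂ (weightedSpace w) :=
  Seminorm.ofSMulLE (fun f => sSup (normSet w m (f : Rn n → ℂ)))
    (by
      have h0 : ∀ k : ℕ, ContDiff ℝ k (0 : Rn n → ℂ) := fun k => contDiff_const
      refine le_antisymm (Real.sSup_le ?_ le_rfl) (Real.sSup_nonneg ?_)
      · rintro _ ⟨i, x, α, -, rfl⟩
        have := multiDeriv_smul α 0 h0
        simp only [zero_smul] at this
        simp [this]
      · rintro _ ⟨i, x, α, -, rfl⟩
        exact norm_nonneg _)
    (by
      intro f g
      have nn : ∀ u : Rn n → ℂ, 0 ≤ sSup (normSet w m u) := fun u =>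
        Real.sSup_nonneg (by rintro _ ⟨i, x, α, -, rfl⟩; exact norm_nonneg _)
      refine Real.sSup_le (fun r hr => ?_) (add_nonneg (nn _) (nn _))
      exact bound_add w m (fun k => (f.2 k).1) (fun k => (g.2 k).1)
        (fun r hr => le_csSup (f.2 m).2 hr) (fun r hr => le_csSup (g.2 m).2 hr) hr)
    (by
      intro c f
      have nn : ∀ u : Rn n → ℂ, 0 ≤ sSup (normSet w m u) := fun u =>
        Real.sSup_nonneg (by rintro _ ⟨i, x, α, -, rfl⟩; exact norm_nonneg _)
      refine Real.sSup_le (fun r hr => ?_) (mul_nonneg (norm_nonneg c) (nn _))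
      exact bound_smul w m c (fun k => (f.2 k).1) (fun r hr => le_csSup (f.2 m).2 hr) hr)

/-- The topology of `weightedSpace w` defined by the family of norms `weightedNorm w m`, `m ∈ ℕ`
(not the topology of pointwise convergence that Mathlib puts on subspaces of `ℝⁿ → ℂ`). -/
@[reducible] def weightedTopology {n : ℕ} {ι : Type} (w : ι → Rn n → ℝ) :
    TopologicalSpace (weightedSpace w) :=
  SeminormFamily.moduleFilterBasis
    (show SeminormFamily ℂ (weightedSpace w) ℕ from weightedNorm w) |>.topology

/-- The sum of the spaces `weightedSpace (w ν)`; for an increasing sequence of spaces this is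
their union (`WeightFamily.coe_limitG`, `WeightFamily.coe_limitGS`). -/
def limitSpace {n : ℕ} {ι : Type} (w : ℕ → ι → Rn n → ℝ) : Submodule ℂ (Rn n → ℂ) :=
  ⨆ ν, weightedSpace (w ν)

/-- `t` is a locally convex vector space topology on the limit space for which all inclusions
`weightedSpace (w ν) → limitSpace w` are continuous. -/
structure IsCompatibleTopology {n : ℕ} {ι : Type} (w : ℕ → ι → Rn n → ℝ)
    (t : TopologicalSpace (limitSpace w)) : Prop where
  addGroup : @IsTopologicalAddGroup (limitSpace w) t _
  smul : @ContinuousSMul ℂ (limitSpace w) _ _ t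
  locallyConvex : @LocallyConvexSpace ℝ (limitSpace w) _ _ _ _ t
  inclusion : ∀ ν, Continuous[weightedTopology (w ν), t]
    (Submodule.inclusion (le_iSup (fun ν => weightedSpace (w ν)) ν))

/-- The (locally convex) inductive limit topology: the finest locally convex topology for which
all inclusions are continuous. -/
@[reducible] def limitTopology {n : ℕ} {ι : Type} (w : ℕ → ι → Rn n → ℝ) :
    TopologicalSpace (limitSpace w) :=
  sInf {t | IsCompatibleTopology w t}

theorem isCompatibleTopology_limitTopology {n : ℕ} {ι : Type} (w : ℕ → ι → Rn n → ℝ) :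
    IsCompatibleTopology w (limitTopology w) where
  addGroup := topologicalAddGroup_sInf fun _ ht => ht.addGroup
  smul := continuousSMul_sInf fun _ ht => ht.smul
  locallyConvex := LocallyConvexSpace.sInf fun _ ht => ht.locallyConvex
  inclusion := fun ν => continuous_sInf_rng.2 fun _ ht => ht.inclusion ν

/-! ### The two scales of spaces -/

/-- The weights `x ↦ x^β / (β! e^{-h(β)})`, `β ∈ ℕⁿ`. -/
def weightG {n : ℕ} (h : Rn n → ℝ) (β : Fin n → ℕ) (x : Rn n) : ℝ :=
  (∏ j, x j ^ β j) / ((∏ j, ((β j).factorial : ℝ)) * Real.exp (-h (natVec β)))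

/-- The single weight `x ↦ 1 / e^{-M(x)}`. -/
def weightGS {n : ℕ} (M : Rn n → ℝ) (_ : Unit) (x : Rn n) : ℝ := 1 / Real.exp (-M x)

/-- `G(h)`: all `f ∈ C^∞(ℝⁿ)` such that for each `m` the norm
`sup {|x^β (D^α f)(x)| / (β! e^{-h(β)}) : x ∈ ℝⁿ, β ∈ ℕⁿ, |α| ≤ m}` is finite. -/
def spaceG {n : ℕ} (h : Rn n → ℝ) : Submodule ℂ (Rn n → ℂ) := weightedSpace (weightG h)

/-- `GS(M)`: all `f ∈ C^∞(ℝⁿ)` such that for each `m` the norm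
`sup {|(D^α f)(x)| / e^{-M(x)} : x ∈ ℝⁿ, |α| ≤ m}` is finite. -/
def spaceGS {n : ℕ} (M : Rn n → ℝ) : Submodule ℂ (Rn n → ℂ) := weightedSpace (weightGS M)

/-- `G(H)`, as a vector space. -/
def limitG {n : ℕ} (h : ℕ → Rn n → ℝ) : Submodule ℂ (Rn n → ℂ) :=
  limitSpace fun ν => weightG (h ν)

/-- `GS(M)` for a sequence `M = (M_ν)`, as a vector space. -/
def limitGS {n : ℕ} (M : ℕ → Rn n → ℝ) : Submodule ℂ (Rn n → ℂ) :=
  limitSpace fun ν => weightGS (M ν)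

/-- The inductive limit topology of `G(H)`. -/
@[reducible] def topologyG {n : ℕ} (h : ℕ → Rn n → ℝ) : TopologicalSpace (limitG h) :=
  limitTopology fun ν => weightG (h ν)

/-- The inductive limit topology of `GS(M)`. -/
@[reducible] def topologyGS {n : ℕ} (M : ℕ → Rn n → ℝ) : TopologicalSpace (limitGS M) :=
  limitTopology fun ν => weightGS (M ν)

/-- The sequence `φ_ν^*`. -/
def phiConj {n : ℕ} (h : ℕ → Rn n → ℝ) (ν : ℕ) : Rn n → ℝ := conj (phi (h ν))

theorem weightedSpace_le {n : ℕ} {ι : Type} {w w' : ι → Rn n → ℝ} {C : ℝ}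
    (hw : ∀ i x, |w' i x| ≤ C * |w i x|) : weightedSpace w ≤ weightedSpace w' := by
  intro f hf m
  obtain ⟨a, ha⟩ := (hf m).2
  refine ⟨(hf m).1, max C 0 * a, ?_⟩
  rintro _ ⟨i, x, α, hα, rfl⟩
  have h1 := ha ⟨i, x, α, hα, rfl⟩
  rw [norm_smul, Real.norm_eq_abs] at h1 ⊢
  calc |w' i x| * ‖multiDeriv α f x‖ ≤ (max C 0 * |w i x|) * ‖multiDeriv α f x‖ := by
        gcongr
        exact (hw i x).trans (by gcongr; exact le_max_left _ _)
    _ = max C 0 * (|w i x| * ‖multiDeriv α f x‖) := by ring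
    _ ≤ max C 0 * a := by gcongr

/-- `G(h_ν) ⊆ G(h_{ν+1})`. -/
theorem WeightFamily.spaceG_le {n : ℕ} {h : ℕ → Rn n → ℝ} (hH : WeightFamily h) (ν : ℕ) :
    spaceG (h ν) ≤ spaceG (h (ν + 1)) := by
  obtain ⟨γ, hγ⟩ := hH.gap ν
  refine weightedSpace_le (C := Real.exp γ) fun β x => ?_
  have h1 := hγ (natVec β) (fun j => by simp [natVec])
  have h2 : 0 ≤ Real.log 2 * ∑ j, natVec β j :=
    mul_nonneg (Real.log_nonneg one_le_two) (Finset.sum_nonneg fun j _ => by simp [natVec])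
  have h3 : Real.exp (h (ν + 1) (natVec β)) ≤ Real.exp γ * Real.exp (h ν (natVec β)) := by
    rw [← Real.exp_add]
    exact Real.exp_le_exp.2 (by linarith)
  have h4 : ∀ μ, |weightG (h μ) β x| =
      |(∏ j, x j ^ β j) / ∏ j, ((β j).factorial : ℝ)| * Real.exp (h μ (natVec β)) := fun μ => by
    rw [weightG, Real.exp_neg, ← div_div, div_inv_eq_mul, abs_mul, Real.abs_exp]
  rw [h4, h4]
  calc _ ≤ |(∏ j, x j ^ β j) / ∏ j, ((β j).factorial : ℝ)| *
        (Real.exp γ * Real.exp (h ν (natVec β))) := by gcongr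
    _ = _ := by ring

/-- `GS(φ_ν^*) ⊆ GS(φ_{ν+1}^*)`. -/
theorem WeightFamily.spaceGS_le {n : ℕ} {h : ℕ → Rn n → ℝ} (hH : WeightFamily h) (ν : ℕ) :
    spaceGS (phiConj h ν) ≤ spaceGS (phiConj h (ν + 1)) := by
  obtain ⟨γ, hγ⟩ := hH.gap ν
  have h1 : ∀ y, h (ν + 1) y ≤ h ν y + γ := fun y => by
    rw [hH.even ν y, hH.even (ν + 1) y]
    have h2 := hγ (absVec y) (fun j => by simp [absVec])
    have h3 : 0 ≤ Real.log 2 * ∑ j, absVec y j :=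
      mul_nonneg (Real.log_nonneg one_le_two) (Finset.sum_nonneg fun j _ => by simp [absVec])
    linarith
  have h4 : ∀ x, phi (h ν) x ≤ phi (h (ν + 1)) x + γ := fun x => by
    refine ciSup_le fun y => ?_
    have h5 := le_ciSup (hH.bddAbove_conj (ν + 1)
      (WithLp.toLp 2 fun j => Real.log (1 + |x j|))) y
    have h6 := h1 y
    change _ ≤ conj (h (ν + 1)) _ + γ
    rw [conj]
    linarith
  have h7 : ∀ x, phiConj h (ν + 1) x ≤ phiConj h ν x + γ := fun x => by
    refine ciSup_le fun y => ?_
    have h5 := le_ciSup (hH.bddAbove_conj_phi ν x) y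
    have h6 := h4 y
    change _ ≤ conj (phi (h ν)) _ + γ
    rw [conj]
    linarith
  refine weightedSpace_le (C := Real.exp γ) fun _ x => ?_
  simp only [weightGS, Real.exp_neg, one_div, inv_inv, Real.abs_exp]
  rw [← Real.exp_add]
  exact Real.exp_le_exp.2 (by linarith [h7 x])

/-- `G(H)` is the union of the spaces `G(h_ν)`. -/
theorem WeightFamily.coe_limitG {n : ℕ} {h : ℕ → Rn n → ℝ} (hH : WeightFamily h) :
    (limitG h : Set (Rn n → ℂ)) = ⋃ ν, (spaceG (h ν) : Set (Rn n → ℂ)) :=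
  Submodule.coe_iSup_of_chain ⟨fun ν => spaceG (h ν), monotone_nat_of_le_succ hH.spaceG_le⟩

/-- `GS(Φ^*)` is the union of the spaces `GS(φ_ν^*)`. -/
theorem WeightFamily.coe_limitGS {n : ℕ} {h : ℕ → Rn n → ℝ} (hH : WeightFamily h) :
    (limitGS (phiConj h) : Set (Rn n → ℂ)) =
      ⋃ ν, (spaceGS (phiConj h ν) : Set (Rn n → ℂ)) :=
  Submodule.coe_iSup_of_chain
    ⟨fun ν => spaceGS (phiConj h ν), monotone_nat_of_le_succ hH.spaceGS_le⟩

end GelfandShilov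

end

open GelfandShilov

namespace GelfandShilov

/-! ### Comparison of systems of weights -/

/-! Both inclusions raise the index `ν` by one and come from estimates at a single point `x`, in
which `|D^α f(x)|` enters only as a nonnegative factor `r`. One constant therefore serves all `m`
and `f`, and each estimate gives both an inclusion of spaces and its continuity (`Dominates`,
`continuous_limitSpace_inclusion`).

From `G(h_ν)` to `GS(φ_{ν+1}^*)` (`WeightFamily.dominates_G_GS`): for fixed `y`, expand `exp (∑
|x_j| |y_j|)` in a power series. Young's inequality bounds `e^{-φ(y)}` by `e^{h(β)} ∏ (1 +
|y_j|)^{-β_j}`, which cancels `|y^β|` in the term of index `β`. What remains is controlled by the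
weights of `G(h_ν)`, and the gap between `h_ν` and `h_{ν+1}` supplies a factor `2^{-|β|}` that makes
the series summable. The bound is uniform in `y`, so it passes to the supremum.

From `GS(φ_ν^*)` to `G(h_{ν+1})` (`WeightFamily.dominates_GS_G`): for fixed `β`, test the supremum
defining `φ_ν^*(x)` at `y = (± e^{t_j})`, where `t` is an approximate subgradient of `h_{ν+1}` at
`β`. There `φ_ν(y) ≤ ⟨t, β⟩ - h_{ν+1}(β) + const`, and `s^k / k! ≤ e^s` with `s = |x_j| e^{t_j}`
recovers `|x^β| / β!`. -/

/-- Pointwise bounds with respect to the weights `w` imply, up to a constant factor, pointwise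
bounds with respect to the weights `w'`. -/
def Dominates {n : ℕ} {ι ι' : Type} (w : ι → Rn n → ℝ) (w' : ι' → Rn n → ℝ) : Prop :=
  ∃ C : ℝ, 0 ≤ C ∧ ∀ (x : Rn n) (r a : ℝ), 0 ≤ r → (∀ i, |w i x| * r ≤ a) →
    ∀ i', |w' i' x| * r ≤ C * a

section Comparison

variable {n : ℕ} {ι ι' : Type}

/-- Take `r = |D^α f(x)|` in the domination; its constant depends only on the weights, hence not on
`m` or `f`. -/
theorem Dominates.exists_upperBounds {w : ι → Rn n → ℝ} {w' : ι' → Rn n → ℝ}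
    (hw : Dominates w w') : ∃ C : ℝ, 0 ≤ C ∧ ∀ (m : ℕ) (f : Rn n → ℂ) (a : ℝ),
      a ∈ upperBounds (normSet w m f) → C * a ∈ upperBounds (normSet w' m f) := by
  obtain ⟨C, hC, hw⟩ := hw
  refine ⟨C, hC, fun m f a ha => ?_⟩
  rintro _ ⟨i', x, α, hα, rfl⟩
  rw [norm_smul, Real.norm_eq_abs]
  refine hw x _ a (norm_nonneg _) (fun i => ?_) i'
  have := ha ⟨i, x, α, hα, rfl⟩
  rwa [norm_smul, Real.norm_eq_abs] at this

theorem Dominates.weightedSpace_le {w : ι → Rn n → ℝ} {w' : ι' → Rn n → ℝ}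
    (hw : Dominates w w') : weightedSpace w ≤ weightedSpace w' := by
  obtain ⟨C, -, hC⟩ := hw.exists_upperBounds
  intro f hf m
  obtain ⟨a, ha⟩ := (hf m).2
  exact ⟨(hf m).1, C * a, hC m f a ha⟩

theorem sSup_normSet_nonneg (w : ι → Rn n → ℝ) (m : ℕ) (f : Rn n → ℂ) :
    0 ≤ sSup (normSet w m f) :=
  Real.sSup_nonneg (by rintro _ ⟨i, x, α, -, rfl⟩; exact norm_nonneg _)

theorem Dominates.exists_weightedNorm_le {w : ι → Rn n → ℝ} {w' : ι' → Rn n → ℝ}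
    (hw : Dominates w w') : ∃ C : ℝ, ∀ (m : ℕ) (f : weightedSpace w),
      weightedNorm w' m (Submodule.inclusion hw.weightedSpace_le f) ≤ C * weightedNorm w m f := by
  obtain ⟨C, hC0, hC⟩ := hw.exists_upperBounds
  refine ⟨C, fun m f => ?_⟩
  change sSup (normSet w' m (f : Rn n → ℂ)) ≤ C * sSup (normSet w m (f : Rn n → ℂ))
  exact Real.sSup_le (fun r hr => hC m f _ (fun r hr => le_csSup (f.2 m).2 hr) hr)
    (mul_nonneg hC0 (sSup_normSet_nonneg w m f))

theorem withSeminorms_weightedTopology (w : ι → Rn n → ℝ) :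
    @WithSeminorms ℂ (weightedSpace w) ℕ _ _ _ (weightedNorm w) (weightedTopology w) :=
  @WithSeminorms.mk _ _ _ _ _ _ _ (weightedTopology w) rfl

theorem Dominates.continuous_inclusion {w : ι → Rn n → ℝ} {w' : ι' → Rn n → ℝ}
    (hw : Dominates w w') : Continuous[weightedTopology w, weightedTopology w']
      (Submodule.inclusion hw.weightedSpace_le) := by
  obtain ⟨C, hC⟩ := hw.exists_weightedNorm_le
  let := weightedTopology w
  let := weightedTopology w'
  refine WithSeminorms.continuous_of_isBounded (withSeminorms_weightedTopology w)
    (withSeminorms_weightedTopology w') _ (Seminorm.IsBounded.of_real fun m => ⟨{m}, C, fun f => ?_⟩)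
  simpa using hC m f

theorem limitSpace_le_of_dominates {w : ℕ → ι → Rn n → ℝ} {w' : ℕ → ι' → Rn n → ℝ}
    (hw : ∀ ν, Dominates (w ν) (w' (ν + 1))) : limitSpace w ≤ limitSpace w' :=
  iSup_le fun ν => (hw ν).weightedSpace_le.trans (le_iSup (fun ν => weightedSpace (w' ν)) (ν + 1))

/-- The topology induced from a compatible topology on a larger limit space is compatible. -/
theorem IsCompatibleTopology.induced {w : ℕ → ι → Rn n → ℝ} {w' : ℕ → ι' → Rn n → ℝ}
    (hw : ∀ ν, Dominates (w ν) (w' (ν + 1))) {t : TopologicalSpace (limitSpace w')}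
    (ht : IsCompatibleTopology w' t) :
    IsCompatibleTopology w
      (t.induced (Submodule.inclusion (limitSpace_le_of_dominates hw))) where
  addGroup :=
    letI := ht.addGroup
    topologicalAddGroup_induced (Submodule.inclusion (limitSpace_le_of_dominates hw))
  smul :=
    letI := ht.smul
    continuousSMul_induced (Submodule.inclusion (limitSpace_le_of_dominates hw))
  locallyConvex :=
    letI := ht.locallyConvex
    LocallyConvexSpace.induced
      ((Submodule.inclusion (limitSpace_le_of_dominates hw)).restrictScalars ℝ)
  inclusion ν := continuous_induced_rng.2
    (@Continuous.comp _ _ _ (weightedTopology (w ν)) (weightedTopology (w' (ν + 1))) t _ _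
      (ht.inclusion (ν + 1)) (hw ν).continuous_inclusion)

/-- The limit topology is the infimum of the compatible ones, so it lies below the topology induced
from the other limit space, which is compatible. -/
theorem continuous_limitSpace_inclusion {w : ℕ → ι → Rn n → ℝ} {w' : ℕ → ι' → Rn n → ℝ}
    (hw : ∀ ν, Dominates (w ν) (w' (ν + 1))) :
    Continuous[limitTopology w, limitTopology w']
      (Submodule.inclusion (limitSpace_le_of_dominates hw)) :=
  continuous_iff_le_induced.2 (sInf_le ((isCompatibleTopology_limitTopology w').induced hw))

/-- Mutually inverse continuous inclusions form an equivalence. -/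
theorem _root_.Submodule.exists_equiv_of_continuous_inclusion {R M : Type*} [Semiring R]
    [AddCommMonoid M] [Module R M] {p q : Submodule R M} {tp : TopologicalSpace p}
    {tq : TopologicalSpace q} (hpq : p ≤ q) (hqp : q ≤ p)
    (h₁ : Continuous[tp, tq] (Submodule.inclusion hpq))
    (h₂ : Continuous[tq, tp] (Submodule.inclusion hqp)) :
    ∃ e : p ≃ₗ[R] q, (∀ f, (e f : M) = f) ∧ Continuous[tp, tq] e ∧ Continuous[tq, tp] e.symm :=
  ⟨LinearEquiv.ofEq p q (le_antisymm hpq hqp), fun _ => rfl, h₁, h₂⟩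

end Comparison

/-! ### The weights of `G(h)` and of `GS(φ^*)` -/

section Weights

variable {n : ℕ}

theorem abs_weightG (g : Rn n → ℝ) (β : Fin n → ℕ) (x : Rn n) :
    |weightG g β x| =
      (∏ j, |x j| ^ β j / ((β j).factorial : ℝ)) * Real.exp (g (natVec β)) := by
  rw [weightG, Real.exp_neg, ← div_div, div_inv_eq_mul, abs_mul, Real.abs_exp,
    ← Finset.prod_div_distrib, Finset.abs_prod]
  congr 1
  refine Finset.prod_congr rfl fun j _ => ?_
  rw [abs_div, abs_pow, Nat.abs_cast]

theorem abs_weightGS (g : Rn n → ℝ) (u : Unit) (x : Rn n) :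
    |weightGS g u x| = Real.exp (g x) := by
  simp only [weightGS, Real.exp_neg, one_div, inv_inv, Real.abs_exp]

theorem natVec_nonneg (β : Fin n → ℕ) (j : Fin n) : 0 ≤ natVec β j := by
  simp [natVec]

/-- The exponential series in several variables. -/
theorem tendsto_sum_prod_pow_div_factorial (z : Fin n → ℝ) :
    Filter.Tendsto (fun N : ℕ => ∑ β ∈ Fintype.piFinset fun _ : Fin n => Finset.range N,
      ∏ j, z j ^ β j / ((β j).factorial : ℝ)) Filter.atTop (𝓝 (Real.exp (∑ j, z j))) := by
  simp_rw [← Finset.prod_univ_sum (fun _ : Fin n => Finset.range _)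
    (fun j k => z j ^ k / ((k).factorial : ℝ)), Real.exp_sum]
  refine tendsto_finsetProd _ fun j _ => ?_
  rw [Real.exp_eq_exp_ℝ]
  exact (NormedSpace.expSeries_div_hasSum_exp (z j)).tendsto_sum_nat

theorem sum_prod_half_pow_le (N : ℕ) :
    ∑ β ∈ Fintype.piFinset fun _ : Fin n => Finset.range N, ∏ j, (1 / 2 : ℝ) ^ β j ≤ 2 ^ n := by
  rw [← Finset.prod_univ_sum (fun _ : Fin n => Finset.range N) (fun _ k => (1 / 2 : ℝ) ^ k)]
  refine (Finset.prod_le_prod (fun j _ => Finset.sum_nonneg fun k _ => by positivity)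
    fun j _ => ?_).trans_eq (b := ∏ _j : Fin n, (2 : ℝ)) (by simp)
  exact sum_geometric_two_le N

end Weights

/-! ### From `G` to `GS`: the exponential series and the Young inequality. -/

namespace WeightFamily

variable {n : ℕ} {h : ℕ → Rn n → ℝ}

/-- The Young inequality for `φ` at a multi-index. -/
theorem exp_neg_phi_le (hH : WeightFamily h) (ν : ℕ) (y : Rn n) (β : Fin n → ℕ) :
    Real.exp (-phi (h ν) y) ≤
      Real.exp (h ν (natVec β)) * ∏ j, ((1 + |y j|) ^ β j)⁻¹ := by
  have h1 := le_ciSup (hH.bddAbove_conj ν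
    (WithLp.toLp 2 fun j => Real.log (1 + |y j|))) (natVec β)
  have h2 : ∏ j, ((1 + |y j|) ^ β j)⁻¹ = Real.exp (-∑ j, Real.log (1 + |y j|) * β j) := by
    rw [← Finset.sum_neg_distrib, Real.exp_sum]
    refine Finset.prod_congr rfl fun j _ => ?_
    rw [Real.exp_neg, mul_comm, Real.exp_nat_mul, Real.exp_log (by positivity)]
  rw [h2, ← Real.exp_add, Real.exp_le_exp]
  change (∑ j, Real.log (1 + |y j|) * (β j : ℝ)) - h ν (natVec β) ≤ phi (h ν) y at h1
  linarith

/-- The gap condition, exponentiated: passing from `ν` to `ν + 1` gains the factor `2^{-|β|}` that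
makes the sum over `β` converge. -/
theorem exp_natVec_le (hH : WeightFamily h) (ν : ℕ) : ∃ γ : ℝ, ∀ β : Fin n → ℕ,
    Real.exp (h (ν + 1) (natVec β)) ≤
      Real.exp γ * Real.exp (h ν (natVec β)) * ∏ j, (1 / 2 : ℝ) ^ β j := by
  obtain ⟨γ, hγ⟩ := hH.gap ν
  refine ⟨γ, fun β => ?_⟩
  have h2 : ∏ j, (1 / 2 : ℝ) ^ β j = Real.exp (-(Real.log 2 * ∑ j, natVec β j)) := by
    rw [Finset.mul_sum, ← Finset.sum_neg_distrib, Real.exp_sum]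
    refine Finset.prod_congr rfl fun j _ => ?_
    rw [Real.exp_neg, mul_comm, natVec, Real.exp_nat_mul, Real.exp_log two_pos, one_div, inv_pow]
  rw [h2, ← Real.exp_add, ← Real.exp_add, Real.exp_le_exp]
  linarith [hγ (natVec β) (natVec_nonneg β)]

theorem dominates_G_GS (hH : WeightFamily h) (ν : ℕ) :
    Dominates (weightG (h ν)) (weightGS (phiConj h (ν + 1))) := by
  obtain ⟨γ, hγ⟩ := hH.exp_natVec_le ν
  refine ⟨Real.exp γ * 2 ^ n, by positivity, fun x r a hr ha u => ?_⟩
  rw [abs_weightGS]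
  -- Any index would do here; `β = 0` is a convenient one.
  have ha0 : 0 ≤ a := (mul_nonneg (abs_nonneg _) hr).trans (ha 0)
  have key : ∀ y : Rn n, Real.exp ((∑ j, x j * y j) - phi (h (ν + 1)) y) * r ≤
      Real.exp γ * 2 ^ n * a := fun y => by
    have hterm : ∀ β : Fin n → ℕ,
        (∏ j, (|x j| * |y j|) ^ β j / ((β j).factorial : ℝ)) *
          (Real.exp (-phi (h (ν + 1)) y) * r) ≤
        (∏ j, (1 / 2 : ℝ) ^ β j) * (Real.exp γ * a) := fun β => by
      have hx0 : 0 ≤ ∏ j, |x j| ^ β j / ((β j).factorial : ℝ) :=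
        Finset.prod_nonneg fun j _ => by positivity
      have hy0 : 0 ≤ ∏ j, |y j| ^ β j := Finset.prod_nonneg fun j _ => by positivity
      have hh0 : 0 ≤ ∏ j, (1 / 2 : ℝ) ^ β j := Finset.prod_nonneg fun j _ => by positivity
      have hsplit : ∏ j, (|x j| * |y j|) ^ β j / ((β j).factorial : ℝ) =
          (∏ j, |x j| ^ β j / ((β j).factorial : ℝ)) * ∏ j, |y j| ^ β j := by
        rw [← Finset.prod_mul_distrib]
        exact Finset.prod_congr rfl fun j _ => by rw [mul_pow]; ring
      have hle1 : (∏ j, |y j| ^ β j) * ∏ j, ((1 + |y j|) ^ β j)⁻¹ ≤ 1 := by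
        rw [← Finset.prod_mul_distrib]
        refine Finset.prod_le_one (fun j _ => by positivity) fun j _ => ?_
        rw [← div_eq_mul_inv, div_le_one (by positivity)]
        gcongr
        linarith
      have hβ := ha β
      rw [abs_weightG] at hβ
      calc _ ≤ ((∏ j, |x j| ^ β j / ((β j).factorial : ℝ)) * ∏ j, |y j| ^ β j) *
              (Real.exp (h (ν + 1) (natVec β)) * (∏ j, ((1 + |y j|) ^ β j)⁻¹) * r) := by
            rw [hsplit]
            gcongr
            exact hH.exp_neg_phi_le (ν + 1) y β
        _ = ((∏ j, |y j| ^ β j) * ∏ j, ((1 + |y j|) ^ β j)⁻¹) *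
              ((∏ j, |x j| ^ β j / ((β j).factorial : ℝ)) *
                Real.exp (h (ν + 1) (natVec β)) * r) := by ring
        _ ≤ 1 * ((∏ j, |x j| ^ β j / ((β j).factorial : ℝ)) *
              (Real.exp γ * Real.exp (h ν (natVec β)) * ∏ j, (1 / 2 : ℝ) ^ β j) * r) := by
            gcongr
            exact hγ β
        _ = (∏ j, (1 / 2 : ℝ) ^ β j) * (Real.exp γ *
              ((∏ j, |x j| ^ β j / ((β j).factorial : ℝ)) *
                Real.exp (h ν (natVec β)) * r)) := by ring
        _ ≤ _ := by gcongr
    -- Sum the termwise bounds over the cubes `β_j < N`, where the geometric factors add up to at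
    -- most `2^n`, and let `N → ∞`.
    have hlim : Real.exp (∑ j, |x j| * |y j|) * (Real.exp (-phi (h (ν + 1)) y) * r) ≤
        Real.exp γ * 2 ^ n * a := by
      refine le_of_tendsto' ((tendsto_sum_prod_pow_div_factorial
        (fun j => |x j| * |y j|)).mul_const _) fun N => ?_
      rw [Finset.sum_mul]
      refine (Finset.sum_le_sum fun β _ => hterm β).trans ?_
      rw [← Finset.sum_mul]
      calc _ ≤ 2 ^ n * (Real.exp γ * a) := by
            gcongr
            exact sum_prod_half_pow_le N
        _ = _ := by ring
    refine le_trans ?_ hlim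
    rw [sub_eq_add_neg, Real.exp_add, mul_assoc]
    refine mul_le_mul_of_nonneg_right (Real.exp_le_exp.2 (Finset.sum_le_sum fun j _ => ?_))
      (by positivity)
    rw [← abs_mul]
    exact le_abs_self _
  rcases hr.eq_or_lt with rfl | hr
  · rw [mul_zero]
    positivity
  · rw [← le_div_iff₀ hr]
    -- Once `r > 0`, the case `y = 0` of `key` makes the bound positive, so its logarithm can bound
    -- the real supremum `φ^*(x)`.
    have hpos : 0 < Real.exp γ * 2 ^ n * a / r :=
      (Real.exp_pos _).trans_le ((le_div_iff₀ hr).2 (key 0))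
    rw [← Real.le_log_iff_exp_le hpos]
    refine ciSup_le fun y => ?_
    rw [Real.le_log_iff_exp_le hpos, le_div_iff₀ hr]
    exact key y

/-! ### From `GS` to `G`: approximate subgradients of the weights. -/

/-- An approximate subgradient of `h_ν` at a point of the orthant, with nonnegative entries. -/
theorem exists_conj_le (hH : WeightFamily h) (ν : ℕ) (b : Rn n) (hb : ∀ j, 0 ≤ b j) :
    ∃ t : Rn n, (∀ j, 0 ≤ t j) ∧ ∀ y : Rn n, (∀ j, 0 ≤ y j) →
      (∑ j, t j * y j) - h ν y ≤ (∑ j, t j * b j) - h ν b + 1 := by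
  -- An affine minorant of `h_ν` that loses at most 1 at `b`; this loss is the `+ 1` in the
  -- conclusion.
  obtain ⟨l, c, hlc, hlb⟩ := ConvexOn.exists_affine_le_of_lt (𝕜 := ℝ) (Set.mem_univ b)
    (sub_one_lt (h ν b)) isClosed_univ
    ((hH.convex ν).locallyLipschitz.continuous.lowerSemicontinuous.lowerSemicontinuousOn _)
    (hH.convex ν)
  have hl : ∀ y : Rn n, l y = ∑ j, l (EuclideanSpace.single j 1) * y j := fun y => by
    conv_lhs => rw [← (EuclideanSpace.basisFun (Fin n) ℝ).sum_repr y]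
    simp [map_sum, mul_comm]
  have hle : ∀ y : Rn n, l y + c ≤ h ν y := fun y => by
    simpa using hlc ⟨y, Set.mem_univ y⟩
  simp only [RCLike.re_to_real] at hlb
  refine ⟨WithLp.toLp 2 fun j => |l (EuclideanSpace.single j 1)|, fun j => abs_nonneg _,
    fun y hy => ?_⟩
  -- flip the signs of the coordinates of `y` according to the signs of `l`
  set z : Rn n := WithLp.toLp 2 fun j => SignType.sign (l (EuclideanSpace.single j 1)) * y j
    with hz
  have h1 : ∑ j, |l (EuclideanSpace.single j 1)| * y j = l z := by
    rw [hl z]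
    refine Finset.sum_congr rfl fun j _ => ?_
    simp only [hz]
    rw [← mul_assoc, self_mul_sign]
  have h2 : h ν z ≤ h ν y := by
    rw [hH.even ν z]
    refine hH.mono ν _ _ (fun j => abs_nonneg _) fun j => ?_
    simp only [absVec, hz]
    rw [abs_mul, abs_of_nonneg (hy j)]
    refine mul_le_of_le_one_left (hy j) ?_
    rcases SignType.sign (l (EuclideanSpace.single j 1)) with _ | _ | _ <;> simp
  have h3 : l b ≤ ∑ j, |l (EuclideanSpace.single j 1)| * b j := by
    rw [hl b]
    exact Finset.sum_le_sum fun j _ => mul_le_mul_of_nonneg_right (le_abs_self _) (hb j)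
  have h4 := hle z
  simp only
  linarith

/-- For `t ≥ 0` one has `ln (1 + e^t) ≤ ln 2 + t`. The gap condition absorbs the term `ln 2 · ∑
|y_j|` in exchange for `h_{ν+1}` in place of `h_ν`, leaving the conjugate of `h_{ν+1}` at `t`, which
is nearly attained at `b` when `t` is an approximate subgradient there. -/
theorem phi_exp_le (hH : WeightFamily h) (ν : ℕ) : ∃ γ : ℝ, ∀ b : Rn n, (∀ j, 0 ≤ b j) →
    ∃ t : Rn n, phi (h ν) (WithLp.toLp 2 fun j => Real.exp (t j)) ≤
      (∑ j, t j * b j) - h (ν + 1) b + γ := by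
  obtain ⟨γ, hγ⟩ := hH.gap ν
  refine ⟨γ + 1, fun b hb => ?_⟩
  -- The subgradient is that of `h_{ν+1}`, the function left after the gap is used; the 1 in `γ + 1`
  -- is its error.
  obtain ⟨t, ht, htb⟩ := hH.exists_conj_le (ν + 1) b hb
  refine ⟨t, ciSup_le fun y => ?_⟩
  have h1 := htb (absVec y) fun j => abs_nonneg _
  have h2 := hγ (absVec y) fun j => abs_nonneg _
  rw [← hH.even ν y] at h2
  have h3 : ∑ j, Real.log (1 + |Real.exp (t j)|) * y j ≤
      Real.log 2 * (∑ j, absVec y j) + ∑ j, t j * absVec y j := by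
    rw [Finset.mul_sum, ← Finset.sum_add_distrib]
    refine Finset.sum_le_sum fun j _ => ?_
    have h4 : Real.log (1 + |Real.exp (t j)|) ≤ Real.log 2 + t j := by
      rw [Real.log_le_iff_le_exp (by positivity), Real.exp_add, Real.exp_log two_pos,
        Real.abs_exp]
      linarith [Real.one_le_exp (ht j)]
    have h5 : 0 ≤ Real.log (1 + |Real.exp (t j)|) :=
      Real.log_nonneg (by linarith [abs_nonneg (Real.exp (t j))])
    calc _ ≤ Real.log (1 + |Real.exp (t j)|) * |y j| :=
          mul_le_mul_of_nonneg_left (le_abs_self _) h5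
      _ ≤ (Real.log 2 + t j) * |y j| := mul_le_mul_of_nonneg_right h4 (abs_nonneg _)
      _ = _ := by simp only [absVec]; ring
  simp only
  linarith

theorem dominates_GS_G (hH : WeightFamily h) (ν : ℕ) :
    Dominates (weightGS (phiConj h ν)) (weightG (h (ν + 1))) := by
  obtain ⟨γ, hγ⟩ := hH.phi_exp_le ν
  refine ⟨Real.exp γ, (Real.exp_pos _).le, fun x r a hr ha β => ?_⟩
  have h1 := ha ()
  rw [abs_weightGS] at h1
  rw [abs_weightG]
  suffices H : (∏ j, |x j| ^ β j / ((β j).factorial : ℝ)) * Real.exp (h (ν + 1) (natVec β)) ≤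
      Real.exp γ * Real.exp (phiConj h ν x) by
    calc _ ≤ Real.exp γ * Real.exp (phiConj h ν x) * r := by gcongr
      _ = Real.exp γ * (Real.exp (phiConj h ν x) * r) := mul_assoc _ _ _
      _ ≤ _ := by gcongr
  obtain ⟨t, ht⟩ := hγ (natVec β) (natVec_nonneg β)
  -- the point `(± e^{t_j})` with the signs of `x`
  set y : Rn n := WithLp.toLp 2 fun j => (if 0 ≤ x j then 1 else -1) * Real.exp (t j) with hy
  have hyabs : ∀ j, |y j| = |Real.exp (t j)| := fun j => by
    simp only [hy, abs_mul]
    split_ifs <;> simp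
  have hphi : phi (h ν) y = phi (h ν) (WithLp.toLp 2 fun j => Real.exp (t j)) := by
    simp only [phi, hyabs]
  have hxy : ∀ j, x j * y j = |x j| * Real.exp (t j) := fun j => by
    simp only [hy]
    split_ifs with hx
    · rw [abs_of_nonneg hx, one_mul]
    · rw [abs_of_neg (not_le.1 hx)]; ring
  have h2 : (∑ j, x j * y j) - phi (h ν) y ≤ phiConj h ν x :=
    le_ciSup (hH.bddAbove_conj_phi ν x) y
  have h3 : ∏ j, |x j| ^ β j / ((β j).factorial : ℝ) ≤
      Real.exp ((∑ j, x j * y j) - ∑ j, t j * natVec β j) := by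
    rw [← Finset.sum_sub_distrib, Real.exp_sum]
    refine Finset.prod_le_prod (fun j _ => by positivity) fun j _ => ?_
    -- One term of the exponential series at `|x_j| e^{t_j}`; dividing by `e^{t_j β_j}` leaves
    -- `|x_j|^{β_j} / β_j!`.
    have h4 := Real.pow_div_factorial_le_exp (x := |x j| * Real.exp (t j)) (by positivity) (β j)
    have h5 : Real.exp (t j * natVec β j) = Real.exp (t j) ^ β j := by
      rw [mul_comm, natVec, Real.exp_nat_mul]
    rw [hxy, Real.exp_sub, h5, le_div_iff₀ (by positivity)]
    calc _ = (|x j| * Real.exp (t j)) ^ β j / ((β j).factorial : ℝ) := by rw [mul_pow]; ring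
      _ ≤ _ := h4
  calc _ ≤ Real.exp ((∑ j, x j * y j) - ∑ j, t j * natVec β j) *
        Real.exp (h (ν + 1) (natVec β)) := by gcongr
    _ ≤ _ := by
      rw [← Real.exp_add, ← Real.exp_add, Real.exp_le_exp]
      linarith

end WeightFamily

end GelfandShilov

theorem theorem5 (n : ℕ) (h : ℕ → Rn n → ℝ) (hH : WeightFamily h) (θ : ℕ → Rn n → ℝ)
    (hconvex : ∀ ν, ConvexOn ℝ Set.univ (θ ν))
    (heven : ∀ ν, EvenInEach (θ ν))
    (hmono : ∀ ν, NondecreasingOnOrthant (θ ν))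
    (hclose : ∀ ν, ∃ a : ℝ, 0 < a ∧ ∀ x, |phi (h ν) x - θ ν x| ≤ a) :
    (⋃ ν, (spaceG (h ν) : Set (Rn n → ℂ))) =
        ⋃ ν, (spaceGS (phiConj h ν) : Set (Rn n → ℂ)) ∧
      ∃ e : limitG h ≃ₗ[ℂ] limitGS (phiConj h),
        (∀ f, (e f : Rn n → ℂ) = f) ∧
        Continuous[topologyG h, topologyGS (phiConj h)] e ∧
        Continuous[topologyGS (phiConj h), topologyG h] e.symm := by
  have h₁ := hH.dominates_G_GS
  have h₂ := hH.dominates_GS_G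
  have hle₁ : limitG h ≤ limitGS (phiConj h) := limitSpace_le_of_dominates h₁
  have hle₂ : limitGS (phiConj h) ≤ limitG h := limitSpace_le_of_dominates h₂
  refine ⟨?_, Submodule.exists_equiv_of_continuous_inclusion hle₁ hle₂
    (continuous_limitSpace_inclusion h₁) (continuous_limitSpace_inclusion h₂)⟩
  rw [← hH.coe_limitG, ← hH.coe_limitGS]
  exact congrArg _ (le_antisymm hle₁ hle₂)
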